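/- Let $G\ge 0$, $\boldsymbol m=(m_1,\dots,m_G)$ with non-negative integers $m_g$, $n=\sum_{g=1}^G m_g$, and $\boldsymbol\nu=(\nu_1,\dots,\nu_G)$ with real $\nu_g>2$. For $\nu>2$ and a positive definite $m\times m$ matrix $\Sigma$, the standardized multivariate $t$ distribution $t^{\mathrm{std}}_\nu(0,\Sigma)$ on $\mathbb R^m$ has density $$y\mapsto \frac{\Gamma(\frac{\nu+m}{2})}{\Gamma(\frac{\nu}{2})}\,[(\nu-2)\pi]^{-m/2}\,|\Sigma|^{-1/2}\Bigl[1+\tfrac{1}{\nu-2}\,y'\Sigma^{-1}y\Bigr]^{-\frac{\nu+m}{2}} .$$ Let $V=(V_1',\dots,V_G')'\in\mathbb R^n$, where $V_1,\dots,V_G$ are independent and $V_g\sim t^{\mathrm{std}}_{\nu_g}(0,I_{m_g})$. For an $n\times n$ matrix $A$, write $\mathrm{CT}^{\mathrm{std}}_{\boldsymbol m,\boldsymbol\nu}(0,A)$ for the law of $AV$. Let $C$ be a symmetric positive semidefinite real $n\times n$ matrix with positive diagonal entries (for example, a correlation matrix), with symmetric positive semidefinite square root $C^{1/2}$. Let $P=(P_1,\dots,P_G)$,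 $P_g\in\mathbb R^{n\times m_g}$, be an $n\times n$ matrix with $P'P=I_n$, and let $Z\sim\mathrm{CT}^{\mathrm{std}}_{\boldsymbol m,\boldsymbol\nu}(0,C^{1/2}P)$. For $\nu>2$ and real $s\neq0$ put $$\varphi^{\mathrm{std}}_\nu(s)=\frac{K_{\nu/2}(\sqrt{\nu-2}\,|s|)\,(\sqrt{\nu-2}\,|s|)^{\nu/2}}{\Gamma(\frac{\nu}{2})\,2^{\frac{\nu}{2}-1}},$$ and $\varphi^{\mathrm{std}}_\nu(0)=1$, where $K_a(x)=\int_0^\infty e^{-x\cosh t}\cosh(at)\,\mathrm dt$ ($x>0$) is the modified Bessel function of the second kind. Then: 1. For every $\nu>2$, $t^{\mathrm{std}}_\nu(0,1)$ is a probability measure on $\mathbb R$ and $\varphi^{\mathrm{std}}_\nu$ is its characteristic function. 2. For every $j=1,\dots,n$, the characteristic function of $Z_j$ is, for all $s\in\mathbb R$, $$\varphi_{Z_j}(s)=\prod_{g=1}^G\varphi^{\mathrm{std}}_{\nu_g}\bigl(s\,\|P_g'C^{1/2}e_j\|\bigr),$$ where $e_j$ is the $j$-th standard basis vector of $\mathbb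 R^n$ and $\|\cdot\|$ is the Euclidean norm. 3. For every $j=1,\dots,n$, $Z_j$ has a density $f_{Z_j}\ge 0$, and this density and the distribution function $F_{Z_j}(z)=\mathbb P(Z_j\le z)$ are given, for all $z\in\mathbb R$, by the absolutely convergent integrals $$f_{Z_j}(z)=\frac1\pi\int_0^\infty \mathrm{Re}\bigl[e^{-isz}\varphi_{Z_j}(s)\bigr]\,\mathrm ds,\qquad F_{Z_j}(z)=\frac12-\frac1\pi\int_0^\infty\frac{\mathrm{Im}\bigl[e^{-isz}\varphi_{Z_j}(s)\bigr]}{s}\,\mathrm ds .$$ -/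

import Mathlib

open MeasureTheory ProbabilityTheory Matrix

/-- Modified Bessel function of the second kind of real order `a`, at real `x > 0`:
`K_a(x) = ∫₀^∞ exp (-x cosh t) cosh (a t) dt`. -/
noncomputable def besselK (a x : ℝ) : ℝ :=
  ∫ t in Set.Ioi (0 : ℝ), Real.exp (-x * Real.cosh t) * Real.cosh (a * t)

/-- Density of the standardized multivariate `t` distribution `t_ν^std(0, S)` on `ℝ^m`
(for `ν > 2` and `S` positive definite). -/
noncomputable def tStdPDF {m : ℕ} (ν : ℝ) (S : Matrix (Fin m) (Fin m) ℝ) (y : Fin m → ℝ) : ℝ :=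
  Real.Gamma ((ν + m) / 2) / Real.Gamma (ν / 2) * ((ν - 2) * Real.pi) ^ (-(m : ℝ) / 2)
    * S.det ^ (-(1 : ℝ) / 2)
    * (1 + 1 / (ν - 2) * (y ⬝ᵥ (S⁻¹ *ᵥ y))) ^ (-(ν + m) / 2)

/-- The standardized multivariate `t` distribution `t_ν^std(0, S)` on `ℝ^m`. -/
noncomputable def tStd {m : ℕ} (ν : ℝ) (S : Matrix (Fin m) (Fin m) ℝ) : Measure (Fin m → ℝ) :=
  volume.withDensity fun y => ENNReal.ofReal (tStdPDF ν S y)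

/-- The univariate standardized `t` distribution `t_ν^std(0, 1)`, as a measure on `ℝ`. -/
noncomputable def tStdReal (ν : ℝ) : Measure ℝ :=
  (tStd ν (1 : Matrix (Fin 1) (Fin 1) ℝ)).map fun y => y 0

/-- Stacking `V = (V_1', …, V_G')'` of blocks `V_g ∈ ℝ^{m_g}` into a vector in `ℝ^n`,
`n = m_1 + ⋯ + m_G`. -/
def stackBlocks {G : ℕ} (m : Fin G → ℕ) (v : ∀ g, Fin (m g) → ℝ) : Fin (∑ g, m g) → ℝ :=
  fun i => v (finSigmaFinEquiv.symm i).1 (finSigmaFinEquiv.symm i).2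

/-- The `g`-th block of columns `P_g ∈ ℝ^{n × m_g}` in the partition `P = (P_1, …, P_G)`. -/
def colBlock {G : ℕ} (m : Fin G → ℕ) (P : Matrix (Fin (∑ g, m g)) (Fin (∑ g, m g)) ℝ) (g : Fin G) :
    Matrix (Fin (∑ g, m g)) (Fin (m g)) ℝ :=
  P.submatrix id fun i => finSigmaFinEquiv ⟨g, i⟩

/-- The standardized convolution-`t` distribution with location zero and scale-rotation matrix `A`:
the law of `A V`, where `V = (V_1', …, V_G')'` and the `V_g` are independent with
`V_g ∼ t_{ν_g}^std(0, I_{m_g})`. -/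
noncomputable def ctStd {G : ℕ} (m : Fin G → ℕ) (ν : Fin G → ℝ)
    (A : Matrix (Fin (∑ g, m g)) (Fin (∑ g, m g)) ℝ) : Measure (Fin (∑ g, m g) → ℝ) :=
  (Measure.pi fun g => tStd (ν g) (1 : Matrix (Fin (m g)) (Fin (m g)) ℝ)).map
    fun v => A *ᵥ stackBlocks m v

open scoped MatrixOrder in
/-- The symmetric positive semidefinite square root `C^{1/2}` of a symmetric positive semidefinite
real matrix `C`. -/
noncomputable def matSqrt {n : ℕ} (C : Matrix (Fin n) (Fin n) ℝ) : Matrix (Fin n) (Fin n) ℝ :=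
  CFC.sqrt C

/-- The function `φ_ν^std`. The Bessel function has a pole at `0`, where the formula is read as its
limit, `1`. -/
noncomputable def tStdCF (ν s : ℝ) : ℝ :=
  if s = 0 then 1
  else besselK (ν / 2) (Real.sqrt (ν - 2) * |s|) * (Real.sqrt (ν - 2) * |s|) ^ (ν / 2)
    / (Real.Gamma (ν / 2) * 2 ^ (ν / 2 - 1))

/-- `s ↦ ∏_g φ_{ν_g}^std (s ‖P_g' C^{1/2} e_j‖)`, with the Euclidean norm on `ℝ^{m_g}`. -/
noncomputable def ctMarginalCF {G : ℕ} (m : Fin G → ℕ) (ν : Fin G → ℝ)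
    (C P : Matrix (Fin (∑ g, m g)) (Fin (∑ g, m g)) ℝ) (j : Fin (∑ g, m g)) (s : ℝ) : ℂ :=
  ∏ g, (tStdCF (ν g)
    (s * ‖WithLp.toLp 2 ((colBlock m P g)ᵀ *ᵥ (matSqrt C *ᵥ Pi.single j 1))‖) : ℂ)

/-! A standardized `t` vector is a Gaussian scale mixture: given a precision `u` with gamma law of
shape `ν/2` and rate `(ν-2)/2`, it is centred normal with covariance `u⁻¹ I`. Hence `v·V_g` has
characteristic function `E exp(-s²|v|²/(2u))`, and an exponential substitution turns this gamma
integral into the Bessel expression `tStdCF` (`integral_exp_neg_div_gammaMeasure`).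

Write `b_g = P_g' C^{1/2} e_j`. Then `Z_j` has the law of `∑ b_g·V_g`, so independence gives the
product formula. The product is again of mixture form, `φ(s) = E exp(-W s²/2)` with `W = ∑
|b_g|²/u_g` and independent `u_g`. Since `∑ |b_g|² = C_jj > 0`, some `b_g` is nonzero, so `W > 0`
almost surely and `W^{-1/2}` is at most a constant times `√u_g`, which is integrable.

For such mixtures inversion needs only Fubini and the Gaussian case. Finiteness of `E W^{-1/2}`
makes `φ` integrable; averaging the Gaussian inversion formula over `W` gives the density, which is
nonnegative and even; integrating it from `0` to `z` and adding the mass `1/2` of the left half-line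
gives the distribution function. -/

/-! ### The gamma mixing law -/

theorem measurable_gammaPDF (a r : ℝ) : Measurable (gammaPDF a r) :=
  (measurable_gammaPDFReal a r).ennreal_ofReal

theorem integral_gammaMeasure {E : Type*} [NormedAddCommGroup E] [NormedSpace ℝ E] {a r : ℝ}
    (ha : 0 < a) (hr : 0 < r) (g : ℝ → E) :
    ∫ x, g x ∂gammaMeasure a r = ∫ x in Set.Ioi (0 : ℝ),
      (r ^ a / Real.Gamma a * x ^ (a - 1) * Real.exp (-(r * x))) • g x := by
  rw [gammaMeasure, integral_withDensity_eq_integral_toReal_smul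
    (measurable_gammaPDF a r) (by simp [gammaPDF]), ← integral_Ici_eq_integral_Ioi,
    ← integral_indicator measurableSet_Ici]
  refine integral_congr_ae (.of_forall fun x => ?_)
  simp only [gammaPDF, ENNReal.toReal_ofReal (gammaPDFReal_nonneg ha hr x)]
  by_cases hx : 0 ≤ x <;> simp [gammaPDFReal, hx]

theorem integrable_gammaMeasure_iff {E : Type*} [NormedAddCommGroup E] [NormedSpace ℝ E] {a r : ℝ}
    (ha : 0 < a) (hr : 0 < r) (g : ℝ → E) :
    Integrable g (gammaMeasure a r) ↔ IntegrableOn (fun x =>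
      (r ^ a / Real.Gamma a * x ^ (a - 1) * Real.exp (-(r * x))) • g x) (Set.Ioi 0) := by
  rw [gammaMeasure, integrable_withDensity_iff_integrable_smul'
    (measurable_gammaPDF a r) (by simp [gammaPDF]), ← integrableOn_Ici_iff_integrableOn_Ioi,
    ← integrable_indicator_iff measurableSet_Ici]
  refine integrable_congr (.of_forall fun x => ?_)
  simp only [gammaPDF, ENNReal.toReal_ofReal (gammaPDFReal_nonneg ha hr x)]
  by_cases hx : 0 ≤ x <;> simp [gammaPDFReal, hx]

theorem ae_pos_gammaMeasure (a r : ℝ) : ∀ᵐ x ∂gammaMeasure a r, 0 < x := by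
  rw [gammaMeasure, ae_withDensity_iff (measurable_gammaPDF a r)]
  -- The gamma density need not vanish at `0`, so that point is discarded as a null set.
  have h0 : ∀ᵐ x : ℝ, x ≠ 0 := by simp [ae_iff]
  filter_upwards [h0] with x hx h
  by_contra! hle
  exact h (gammaPDF_of_neg (lt_of_le_of_ne hle hx))

/-- Supplies the moment that bounds `E W^{-1/2}` for the mixing variance `W` of a coordinate. -/
theorem integrable_sqrt_gammaMeasure {a r : ℝ} (ha : 0 < a) (hr : 0 < r) :
    Integrable Real.sqrt (gammaMeasure a r) := by
  rw [integrable_gammaMeasure_iff ha hr]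
  have h := (integrableOn_rpow_mul_exp_neg_mul_rpow (p := 1) (s := a - 1 / 2) (b := r)
    (by linarith) one_pos hr).const_mul (r ^ a / Real.Gamma a)
  refine IntegrableOn.congr_fun h (fun x hx => ?_) measurableSet_Ioi
  have hx : 0 < x := hx
  simp only [smul_eq_mul, Real.sqrt_eq_rpow, Real.rpow_one]
  rw [show a - 1 / 2 = (a - 1) + 1 / 2 by ring, Real.rpow_add hx, neg_mul]
  ring

/-! ### The `t` distribution as a Gaussian scale mixture -/

/-- The centred Gaussian density on `ℝ^m` with covariance matrix `u⁻¹ I`. -/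
noncomputable def gaussPrecisionPDF {m : ℕ} (u : ℝ) (y : Fin m → ℝ) : ℝ :=
  (u / (2 * Real.pi)) ^ ((m : ℝ) / 2) * Real.exp (-(u / 2) * ∑ i, y i ^ 2)

theorem measurable_gaussPrecisionPDF (m : ℕ) :
    Measurable (fun p : ℝ × (Fin m → ℝ) => gaussPrecisionPDF p.1 p.2) := by
  unfold gaussPrecisionPDF
  fun_prop

theorem gaussPrecisionPDF_nonneg {m : ℕ} {u : ℝ} (hu : 0 ≤ u) (y : Fin m → ℝ) :
    0 ≤ gaussPrecisionPDF u y := by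
  unfold gaussPrecisionPDF; positivity

theorem gaussPrecisionPDF_mul_cexp {m : ℕ} (u : ℝ) (y v : Fin m → ℝ) :
    (gaussPrecisionPDF u y : ℂ) * Complex.exp (Complex.I * (v ⬝ᵥ y : ℝ)) =
      ((u / (2 * Real.pi)) ^ ((m : ℝ) / 2) : ℝ) *
        Complex.exp (-(u / 2 : ℂ) * ∑ i, (y i : ℂ) ^ 2 + ∑ i, (Complex.I * v i) * y i) := by
  rw [gaussPrecisionPDF, Complex.exp_add]
  push_cast [dotProduct]
  simp only [Finset.mul_sum, mul_assoc]

theorem integrable_gaussPrecisionPDF_mul_cexp {m : ℕ} {u : ℝ} (hu : 0 < u) (v : Fin m → ℝ) :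
    Integrable fun y => (gaussPrecisionPDF u y : ℂ) * Complex.exp (Complex.I * (v ⬝ᵥ y : ℝ)) := by
  simp only [gaussPrecisionPDF_mul_cexp]
  exact (GaussianFourier.integrable_cexp_neg_mul_sum_add (b := (u / 2 : ℂ))
    (by simpa using hu) _).const_mul _

theorem integral_gaussPrecisionPDF_mul_cexp {m : ℕ} {u : ℝ} (hu : 0 < u) (v : Fin m → ℝ) :
    ∫ y, (gaussPrecisionPDF u y : ℂ) * Complex.exp (Complex.I * (v ⬝ᵥ y : ℝ)) =
      (Real.exp (-(∑ i, v i ^ 2) / (2 * u)) : ℝ) := by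
  simp only [gaussPrecisionPDF_mul_cexp]
  rw [integral_const_mul, GaussianFourier.integral_cexp_neg_mul_sum_add (b := (u / 2 : ℂ))
    (by simpa using hu), ← mul_assoc]
  have h1 : ((Real.pi : ℂ) / (u / 2)) ^ ((Fintype.card (Fin m) : ℂ) / 2) =
      (((u / (2 * Real.pi)) ^ ((m : ℝ) / 2))⁻¹ : ℝ) := by
    rw [← Real.inv_rpow (by positivity), Complex.ofReal_cpow (by positivity)]
    push_cast
    rw [Fintype.card_fin]
    congr 1
    have : (Real.pi : ℂ) ≠ 0 := by simp [Real.pi_ne_zero]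
    have : (u : ℂ) ≠ 0 := by simp [hu.ne']
    field_simp
  rw [h1, ← Complex.ofReal_mul, mul_inv_cancel₀ (by positivity), Complex.ofReal_one, one_mul]
  push_cast
  congr 1
  simp only [mul_pow, Complex.I_sq, ← Finset.mul_sum]
  have : (u : ℂ) ≠ 0 := by simp [hu.ne']
  field_simp
  ring

theorem integral_gaussPrecisionPDF {m : ℕ} {u : ℝ} (hu : 0 < u) :
    ∫ y : Fin m → ℝ, gaussPrecisionPDF u y = 1 := by
  have h := integral_gaussPrecisionPDF_mul_cexp (m := m) hu 0
  simp at h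
  exact_mod_cast h

/-- As a function of the precision `x`, the integrand is a constant times `x ^ ((ν + m) / 2 - 1) *
exp (-(r + q / 2) x)`, again a gamma kernel. The rate `r = (ν - 2) / 2` produces the factor `1 / (ν
- 2)` of the standardized density. -/
theorem integral_gaussPrecisionPDF_gammaMeasure {m : ℕ} {ν : ℝ} (hν : 2 < ν) (y : Fin m → ℝ) :
    ∫ u, gaussPrecisionPDF u y ∂gammaMeasure (ν / 2) ((ν - 2) / 2) = tStdPDF ν 1 y := by
  obtain ⟨r, hr⟩ : ∃ r, r = (ν - 2) / 2 := ⟨_, rfl⟩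
  have hr0 : 0 < r := by linarith
  have h2r : ν - 2 = 2 * r := by linarith
  rw [← hr, integral_gammaMeasure (by linarith) hr0]
  have hq : 0 ≤ ∑ i, y i ^ 2 := Finset.sum_nonneg fun i _ => sq_nonneg _
  set q := ∑ i, y i ^ 2 with hqdef
  have key : ∀ x ∈ Set.Ioi (0 : ℝ),
      (r ^ (ν / 2) / Real.Gamma (ν / 2) * x ^ (ν / 2 - 1) * Real.exp (-(r * x))) •
        gaussPrecisionPDF x y =
      (r ^ (ν / 2) / Real.Gamma (ν / 2) * (2 * Real.pi) ^ (-((m : ℝ) / 2))) *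
        (x ^ ((ν + m) / 2 - 1) * Real.exp (-((r + q / 2) * x))) := by
    intro x hx
    have hx : 0 < x := hx
    rw [gaussPrecisionPDF, ← hqdef, show (ν + m) / 2 - 1 = (ν / 2 - 1) + m / 2 by ring,
      Real.rpow_add hx, show -((r + q / 2) * x) = -(r * x) + -(x / 2) * q by ring, Real.exp_add,
      Real.div_rpow hx.le (by positivity), Real.rpow_neg (by positivity), smul_eq_mul]
    ring
  rw [setIntegral_congr_fun measurableSet_Ioi key, integral_const_mul,
    Real.integral_rpow_mul_exp_neg_mul_Ioi (by positivity) (by positivity), tStdPDF]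
  have hyy : y ⬝ᵥ ((1 : Matrix (Fin m) (Fin m) ℝ)⁻¹ *ᵥ y) = q := by
    simp [hqdef, dotProduct, pow_two]
  have hbase : 1 + 1 / (2 * r) * q = (r + q / 2) / r := by field_simp
  rw [hyy, h2r, hbase, det_one, Real.one_rpow, show -(ν + m) / 2 = -((ν + m) / 2) by ring,
    show -(m : ℝ) / 2 = -((m : ℝ) / 2) by ring,
    show 2 * r * Real.pi = r * (2 * Real.pi) by ring, Real.mul_rpow hr0.le (by positivity),
    Real.rpow_neg (by positivity : 0 ≤ (r + q / 2) / r), Real.div_rpow (by positivity) hr0.le,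
    one_div, Real.inv_rpow (by positivity), Real.rpow_neg hr0.le,
    show (ν + m) / 2 = ν / 2 + m / 2 by ring, Real.rpow_add hr0]
  field_simp

/-- The exponential has modulus one, so for almost every `u` the inner integral of the norm is the
Gaussian mass `1`, and the mixing law is finite. -/
theorem integrable_gaussPrecisionPDF_prod {m : ℕ} {ν : ℝ} (hν : 2 < ν) (v : Fin m → ℝ) :
    Integrable (fun p : ℝ × (Fin m → ℝ) =>
      (gaussPrecisionPDF p.1 p.2 : ℂ) * Complex.exp (Complex.I * (v ⬝ᵥ p.2 : ℝ)))
      ((gammaMeasure (ν / 2) ((ν - 2) / 2)).prod volume) := by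
  have := isProbabilityMeasure_gammaMeasure (a := ν / 2) (r := (ν - 2) / 2)
    (by linarith) (by linarith)
  have hm : Measurable fun p : ℝ × (Fin m → ℝ) =>
      (gaussPrecisionPDF p.1 p.2 : ℂ) * Complex.exp (Complex.I * (v ⬝ᵥ p.2 : ℝ)) := by
    have h1 := measurable_gaussPrecisionPDF m
    have h2 : Measurable fun p : ℝ × (Fin m → ℝ) => v ⬝ᵥ p.2 := by
      unfold dotProduct
      fun_prop
    fun_prop
  rw [integrable_prod_iff hm.aestronglyMeasurable]
  refine ⟨(ae_pos_gammaMeasure _ _).mono fun u hu => integrable_gaussPrecisionPDF_mul_cexp hu v, ?_⟩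
  refine (integrable_const (1 : ℝ)).congr ((ae_pos_gammaMeasure _ _).mono fun u hu => ?_)
  simp only
  rw [← integral_gaussPrecisionPDF (m := m) hu]
  refine integral_congr_ae (.of_forall fun y => ?_)
  simp only [norm_mul, mul_comm Complex.I, Complex.norm_exp_ofReal_mul_I, mul_one,
    Complex.norm_real, Real.norm_eq_abs, abs_of_nonneg (gaussPrecisionPDF_nonneg hu.le y)]

theorem tStdPDF_one_nonneg {m : ℕ} {ν : ℝ} (hν : 2 < ν) (y : Fin m → ℝ) :
    0 ≤ tStdPDF ν 1 y := by
  rw [← integral_gaussPrecisionPDF_gammaMeasure hν]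
  exact integral_nonneg_of_ae
    ((ae_pos_gammaMeasure _ _).mono fun u hu => gaussPrecisionPDF_nonneg (le_of_lt hu) y)

theorem continuous_tStdPDF_one {m : ℕ} {ν : ℝ} (hν : 2 < ν) :
    Continuous (tStdPDF (m := m) ν 1) := by
  unfold tStdPDF dotProduct
  refine continuous_const.mul (Continuous.rpow_const (by simp; fun_prop) fun y => .inl ?_)
  have : 0 ≤ ∑ i, y i * y i := Finset.sum_nonneg fun i _ => mul_self_nonneg _
  have : 0 < ν - 2 := by linarith
  simp only [inv_one, one_mulVec]
  positivity

theorem integral_tStd_one {m : ℕ} {ν : ℝ} (hν : 2 < ν) (g : (Fin m → ℝ) → ℂ) :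
    ∫ y, g y ∂tStd ν 1 = ∫ y, (tStdPDF ν 1 y : ℂ) * g y := by
  rw [tStd, integral_withDensity_eq_integral_toReal_smul
    (continuous_tStdPDF_one hν).measurable.ennreal_ofReal (by simp)]
  simp [ENNReal.toReal_ofReal (tStdPDF_one_nonneg hν _)]

/-- The standardized `t` distribution is a scale mixture of centred Gaussian distributions. -/
theorem integral_cexp_tStd_one {m : ℕ} {ν : ℝ} (hν : 2 < ν) (v : Fin m → ℝ) :
    ∫ y, Complex.exp (Complex.I * (v ⬝ᵥ y : ℝ)) ∂tStd ν 1 =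
      (∫ u, Real.exp (-(∑ i, v i ^ 2) / (2 * u)) ∂gammaMeasure (ν / 2) ((ν - 2) / 2) : ℝ) := by
  have := isProbabilityMeasure_gammaMeasure (a := ν / 2) (r := (ν - 2) / 2)
    (by linarith) (by linarith)
  rw [integral_tStd_one hν]
  simp only [← integral_gaussPrecisionPDF_gammaMeasure hν]
  rw [← integral_complex_ofReal]
  simp only [← integral_complex_ofReal, ← integral_mul_const]
  rw [← integral_integral_swap (integrable_gaussPrecisionPDF_prod hν v)]
  exact integral_congr_ae ((ae_pos_gammaMeasure _ _).mono fun u hu =>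
    integral_gaussPrecisionPDF_mul_cexp hu v)

theorem isProbabilityMeasure_tStd_one {m : ℕ} {ν : ℝ} (hν : 2 < ν) :
    IsProbabilityMeasure (tStd ν (1 : Matrix (Fin m) (Fin m) ℝ)) := by
  have := isProbabilityMeasure_gammaMeasure (a := ν / 2) (r := (ν - 2) / 2)
    (by linarith) (by linarith)
  -- At `v = 0` the mixture identity reads off both integrability and total mass of the density.
  have hi := (integrable_gaussPrecisionPDF_prod (m := m) hν 0).integral_prod_right.re
  have h1 := integral_cexp_tStd_one hν (0 : Fin m → ℝ)
  rw [integral_tStd_one hν] at h1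
  simp only [integral_complex_ofReal, zero_dotProduct, Complex.ofReal_zero, mul_zero,
    Complex.exp_zero, mul_one, integral_gaussPrecisionPDF_gammaMeasure hν,
    RCLike.re_eq_complex_re, Complex.ofReal_re] at hi h1
  simp at h1
  refine ⟨?_⟩
  rw [tStd, withDensity_apply _ .univ, Measure.restrict_univ,
    ← ofReal_integral_eq_lintegral_ofReal hi (.of_forall (tStdPDF_one_nonneg hν))]
  rw [show ∫ y : Fin m → ℝ, tStdPDF ν 1 y = 1 by exact_mod_cast h1, ENNReal.ofReal_one]

/-! ### From the gamma integral to the Bessel function -/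

/-- Averaging with the reflection `t ↦ -t` replaces `exp (a t)` by `cosh (a t)`; the resulting even
integrand folds onto the half-line. -/
theorem integral_exp_mul_eq_two_mul_besselK (a x : ℝ)
    (h : Integrable fun t => Real.exp (a * t) * Real.exp (-x * Real.cosh t)) :
    ∫ t, Real.exp (a * t) * Real.exp (-x * Real.cosh t) = 2 * besselK a x := by
  have h' := h.comp_neg
  have hs := integral_add h h'
  have hn : ∫ t, Real.exp (a * -t) * Real.exp (-x * Real.cosh (-t)) =
    ∫ t, Real.exp (a * t) * Real.exp (-x * Real.cosh t) :=
      integral_neg_eq_self (fun t => Real.exp (a * t) * Real.exp (-x * Real.cosh t)) volume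
  rw [hn] at hs
  have he : ∀ t : ℝ, Real.exp (a * t) * Real.exp (-x * Real.cosh t) +
      Real.exp (a * -t) * Real.exp (-x * Real.cosh (-t)) =
      2 * (fun t => Real.exp (-x * Real.cosh t) * Real.cosh (a * t)) |t| := by
    intro t
    have : Real.cosh (a * |t|) = Real.cosh (a * t) := by
      rcases abs_choice t with h | h <;> simp [h]
    simp only [Real.cosh_abs, Real.cosh_neg, this]
    rw [Real.cosh_eq (a * t)]
    ring_nf
  rw [integral_congr_ae (.of_forall he), integral_const_mul, integral_comp_abs
    (f := fun t => Real.exp (-x * Real.cosh t) * Real.cosh (a * t)), ← besselK] at hs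
  linarith

/-- The Laplace-type transform of the inverse gamma distribution is a Bessel function. -/
theorem integral_exp_neg_div_gammaMeasure {ν : ℝ} (hν : 2 < ν) (s : ℝ) :
    ∫ u, Real.exp (-(s ^ 2) / (2 * u)) ∂gammaMeasure (ν / 2) ((ν - 2) / 2) = tStdCF ν s := by
  have hprob := isProbabilityMeasure_gammaMeasure (a := ν / 2) (r := (ν - 2) / 2)
    (by linarith) (by linarith)
  rcases eq_or_ne s 0 with rfl | hs
  · simp [tStdCF]
  have hint : Integrable (fun u : ℝ => Real.exp (-(s ^ 2) / (2 * u)))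
      (gammaMeasure (ν / 2) ((ν - 2) / 2)) := by
    refine (integrable_const (1 : ℝ)).mono' (Measurable.aestronglyMeasurable (by fun_prop)) ?_
    filter_upwards [ae_pos_gammaMeasure (ν / 2) ((ν - 2) / 2)] with u hu
    rw [Real.norm_eq_abs, Real.abs_exp, Real.exp_le_one_iff]
    exact div_nonpos_of_nonpos_of_nonneg (by nlinarith [sq_nonneg s]) (by positivity)
  obtain ⟨k, hk⟩ : ∃ k, k = Real.sqrt (ν - 2) := ⟨_, rfl⟩
  have hk0 : 0 < k := hk ▸ Real.sqrt_pos.2 (by linarith)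
  have hk2 : (ν - 2) / 2 = k ^ 2 / 2 := by rw [hk, Real.sq_sqrt (by linarith)]
  have hs0 : 0 < |s| := abs_pos.2 hs
  rw [tStdCF, if_neg hs, ← hk]
  rw [integrable_gammaMeasure_iff (by linarith) (by linarith), hk2] at hint
  rw [integral_gammaMeasure (by linarith) (by linarith), hk2]
  set a := ν / 2 with ha
  have ha0 : 0 < a := by linarith
  -- The substitution `u = (|s| / k) exp t` balances the two exponents: `k² u / 2 + s² / (2 u) = k
  -- |s| cosh t`. Integrability is transported along with the integral.
  have himg : (fun t => |s| / k * Real.exp t) '' Set.univ = Set.Ioi 0 := by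
    ext x
    simp only [Set.image_univ, Set.mem_range, Set.mem_Ioi]
    refine ⟨by rintro ⟨t, rfl⟩; positivity, fun hx => ⟨Real.log (x / (|s| / k)), ?_⟩⟩
    rw [Real.exp_log (by positivity)]
    field_simp
  have hder : ∀ t ∈ Set.univ, HasDerivWithinAt (fun t => |s| / k * Real.exp t)
      (|s| / k * Real.exp t) Set.univ t := fun t _ =>
    ((Real.hasDerivAt_exp t).const_mul _).hasDerivWithinAt
  have hinj : Set.InjOn (fun t => |s| / k * Real.exp t) Set.univ := by
    intro x _ y _ hxy
    exact Real.exp_injective (mul_left_cancel₀ (by positivity) hxy)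
  have hform : ∀ t : ℝ, |(|s| / k * Real.exp t)| •
      (((k ^ 2 / 2) ^ a / Real.Gamma a * (|s| / k * Real.exp t) ^ (a - 1) *
        Real.exp (-(k ^ 2 / 2 * (|s| / k * Real.exp t)))) •
        Real.exp (-(s ^ 2) / (2 * (|s| / k * Real.exp t)))) =
      ((k ^ 2 / 2) ^ a / Real.Gamma a * (|s| / k) ^ a) *
        (Real.exp (a * t) * Real.exp (-(k * |s|) * Real.cosh t)) := by
    intro t
    have h1 : |s| / k * Real.exp t * (|s| / k * Real.exp t) ^ (a - 1) =
        (|s| / k) ^ a * Real.exp (a * t) := by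
      rw [Real.rpow_sub_one (by positivity), mul_div_cancel₀ _ (by positivity),
        Real.mul_rpow (by positivity) (by positivity), ← Real.exp_mul, mul_comm t]
    have h2 : Real.exp (-(k ^ 2 / 2 * (|s| / k * Real.exp t))) *
        Real.exp (-(s ^ 2) / (2 * (|s| / k * Real.exp t))) =
        Real.exp (-(k * |s|) * Real.cosh t) := by
      rw [← Real.exp_add, Real.cosh_eq, Real.exp_neg, ← sq_abs s]
      congr 1
      field_simp
      ring
    rw [abs_of_pos (by positivity), ← h2, smul_eq_mul, smul_eq_mul]
    linear_combination ((k ^ 2 / 2) ^ a / Real.Gamma a *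
      (Real.exp (-(k ^ 2 / 2 * (|s| / k * Real.exp t))) *
        Real.exp (-(s ^ 2) / (2 * (|s| / k * Real.exp t))))) * h1
  rw [← himg, integrableOn_image_iff_integrableOn_abs_deriv_smul .univ hder hinj,
    integrableOn_univ] at hint
  rw [← himg, integral_image_eq_integral_abs_deriv_smul .univ hder hinj, Measure.restrict_univ]
  simp only [hform] at hint ⊢
  rw [integrable_const_mul_iff (by
    have := Real.Gamma_pos_of_pos ha0
    exact (IsUnit.mk0 _ (by positivity)))] at hint
  rw [integral_const_mul, integral_exp_mul_eq_two_mul_besselK _ _ hint]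
  have h3 : (k ^ 2 / 2) ^ a * (|s| / k) ^ a = (k * |s|) ^ a / 2 ^ a := by
    rw [← Real.mul_rpow (by positivity) (by positivity), ← Real.div_rpow (by positivity) (by norm_num)]
    congr 1
    field_simp
  rw [Real.rpow_sub_one (by norm_num)]
  have := Real.Gamma_pos_of_pos ha0
  have h2a : (0 : ℝ) < 2 ^ a := by positivity
  rw [eq_div_iff (by positivity)] at h3
  field_simp
  linear_combination besselK a (k * |s|) * h3

/-! ### Fourier inversion for Gaussian scale mixtures -/

theorem integral_cos_mul_exp_neg_mul_sq {b : ℝ} (hb : 0 < b) (z : ℝ) :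
    ∫ s : ℝ, Real.cos (s * z) * Real.exp (-b * s ^ 2) =
      Real.sqrt (Real.pi / b) * Real.exp (-z ^ 2 / (4 * b)) := by
  have h := fourierIntegral_gaussian (b := (b : ℂ)) (by simpa using hb) z
  have hr : ((Real.pi : ℂ) / b) ^ (1 / 2 : ℂ) * Complex.exp (-(z : ℂ) ^ 2 / (4 * b)) =
      ((Real.sqrt (Real.pi / b) * Real.exp (-z ^ 2 / (4 * b)) : ℝ) : ℂ) := by
    rw [Real.sqrt_eq_rpow, Complex.ofReal_mul, Complex.ofReal_cpow (by positivity)]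
    push_cast
    rfl
  have hf : ∀ s : ℝ, Complex.exp (Complex.I * z * s) * Complex.exp (-b * s ^ 2) =
      Complex.exp ((s * z : ℝ) * Complex.I) * (Real.exp (-b * s ^ 2) : ℝ) := by
    intro s
    push_cast
    ring_nf
  have hint : Integrable fun s : ℝ =>
      Complex.exp ((s * z : ℝ) * Complex.I) * (Real.exp (-b * s ^ 2) : ℝ) :=
    (integrable_exp_neg_mul_sq hb).ofReal.bdd_mul (c := 1)
      (Measurable.aestronglyMeasurable (by fun_prop))
      (.of_forall fun s => (Complex.norm_exp_ofReal_mul_I _).le)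
  rw [hr] at h
  simp only [hf] at h
  rw [← Complex.ofReal_re (Real.sqrt _ * _), ← h]
  refine Eq.trans ?_ (integral_re hint)
  refine integral_congr_ae (.of_forall fun s => ?_)
  simp only [RCLike.re_eq_complex_re]
  rw [Complex.re_mul_ofReal, Complex.exp_ofReal_mul_I_re]

section ScaleMixture

variable {U : Type*} [MeasurableSpace U] {κ : Measure U} {w : U → ℝ} {φ : ℝ → ℝ}

/-- Integrating over the real variable first gives `√(2π / w)`, so `hint` is exactly what Tonelli
requires. -/
theorem integrable_prod_exp_neg_mul_sq [SFinite κ] (hw : Measurable w) (hpos : ∀ᵐ u ∂κ, 0 < w u)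
    (hint : Integrable (fun u => (Real.sqrt (w u))⁻¹) κ) :
    Integrable (fun p : U × ℝ => Real.exp (-(w p.1 / 2) * p.2 ^ 2)) (κ.prod volume) := by
  rw [integrable_prod_iff (Measurable.aestronglyMeasurable (by fun_prop))]
  refine ⟨hpos.mono fun u hu => integrable_exp_neg_mul_sq (half_pos hu), ?_⟩
  refine (hint.const_mul (Real.sqrt (2 * Real.pi))).congr (hpos.mono fun u hu => ?_)
  simp only [Real.norm_eq_abs, Real.abs_exp]
  rw [integral_gaussian, ← Real.sqrt_inv, ← Real.sqrt_mul (by positivity)]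
  congr 1
  field_simp

theorem integrable_of_scaleMixture [SFinite κ] (hw : Measurable w) (hpos : ∀ᵐ u ∂κ, 0 < w u)
    (hint : Integrable (fun u => (Real.sqrt (w u))⁻¹) κ)
    (hφ : ∀ s, φ s = ∫ u, Real.exp (-(w u / 2) * s ^ 2) ∂κ) : Integrable φ :=
  (integrable_prod_exp_neg_mul_sq hw hpos hint).integral_prod_right.congr
    (.of_forall fun s => (hφ s).symm)

theorem gaussianPDFReal_toNNReal {v : ℝ} (hv : 0 < v) (z : ℝ) :
    gaussianPDFReal 0 v.toNNReal z =
      1 / Real.pi * (1 / 2 * ∫ s, Real.cos (s * z) * Real.exp (-(v / 2) * s ^ 2)) := by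
  have hpi := Real.pi_pos
  rw [integral_cos_mul_exp_neg_mul_sq (half_pos hv), gaussianPDFReal, Real.coe_toNNReal _ hv.le,
    ← mul_assoc, ← mul_assoc, sub_zero]
  congr 1
  · rw [← Real.sqrt_inv, Real.sqrt_eq_iff_mul_self_eq (by positivity) (by positivity)]
    have : Real.sqrt (Real.pi / (v / 2)) ^ 2 = Real.pi / (v / 2) := Real.sq_sqrt (by positivity)
    have e : (2 * Real.pi * v)⁻¹ = (1 / Real.pi * (1 / 2)) ^ 2 * (Real.pi / (v / 2)) := by
      field_simp
    linear_combination e - (1 / Real.pi * (1 / 2)) ^ 2 * this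
  · congr 1
    field_simp
    ring

/-- Evenness extends the integral to the whole line; Fubini then reduces it to Gaussian inversion at
each fixed variance `w u`. -/
theorem integral_cos_mul_scaleMixture [SFinite κ] (hw : Measurable w) (hpos : ∀ᵐ u ∂κ, 0 < w u)
    (hint : Integrable (fun u => (Real.sqrt (w u))⁻¹) κ)
    (hφ : ∀ s, φ s = ∫ u, Real.exp (-(w u / 2) * s ^ 2) ∂κ) (z : ℝ) :
    1 / Real.pi * ∫ s in Set.Ioi (0 : ℝ), Real.cos (s * z) * φ s =
      ∫ u, gaussianPDFReal 0 (w u).toNNReal z ∂κ := by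
  have heven : ∀ s : ℝ, Real.cos (s * z) * φ s = (fun s => Real.cos (s * z) * φ s) |s| := by
    intro s
    rcases abs_choice s with h | h <;> simp [h, hφ]
  have h2 : ∫ s in Set.Ioi (0 : ℝ), Real.cos (s * z) * φ s =
      1 / 2 * ∫ s, Real.cos (s * z) * φ s := by
    have h := (integral_congr_ae (μ := volume) (.of_forall heven)).trans
      (integral_comp_abs (f := fun s => Real.cos (s * z) * φ s))
    linarith
  have hswap : ∫ s, Real.cos (s * z) * φ s =
      ∫ u, (∫ s, Real.cos (s * z) * Real.exp (-(w u / 2) * s ^ 2)) ∂κ := by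
    rw [integral_integral_swap]
    · simp only [hφ, integral_const_mul]
    · exact (integrable_prod_exp_neg_mul_sq hw hpos hint).bdd_mul (c := 1)
        (Measurable.aestronglyMeasurable (by fun_prop))
        (.of_forall fun p => Real.abs_cos_le_one _)
  rw [h2, hswap, ← integral_const_mul, ← integral_const_mul]
  exact integral_congr_ae (hpos.mono fun u hu => (gaussianPDFReal_toNNReal hu z).symm)

theorem integrable_prod_gaussianPDFReal [IsFiniteMeasure κ] (hw : Measurable w)
    (hpos : ∀ᵐ u ∂κ, 0 < w u) :
    Integrable (fun p : U × ℝ => gaussianPDFReal 0 (w p.1).toNNReal p.2) (κ.prod volume) := by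
  have hm : Measurable fun p : U × ℝ => gaussianPDFReal 0 (w p.1).toNNReal p.2 := by
    unfold gaussianPDFReal
    fun_prop
  rw [integrable_prod_iff hm.aestronglyMeasurable]
  refine ⟨.of_forall fun u => integrable_gaussianPDFReal 0 (w u).toNNReal, ?_⟩
  refine (integrable_const (1 : ℝ)).congr (hpos.mono fun u hu => ?_)
  simp only [Real.norm_eq_abs, abs_of_nonneg (gaussianPDFReal_nonneg _ _ _)]
  rw [integral_gaussianPDFReal_eq_one _ (by simpa using hu)]

theorem scaleMixture_density_nonneg (z : ℝ) :
    0 ≤ ∫ u, gaussianPDFReal 0 (w u).toNNReal z ∂κ :=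
  integral_nonneg fun _ => gaussianPDFReal_nonneg _ _ _

theorem integrable_scaleMixture_density [IsFiniteMeasure κ] (hw : Measurable w)
    (hpos : ∀ᵐ u ∂κ, 0 < w u) :
    Integrable (fun z => ∫ u, gaussianPDFReal 0 (w u).toNNReal z ∂κ) :=
  (integrable_prod_gaussianPDFReal hw hpos).integral_prod_right

/-- The mixture of Gaussian densities has characteristic function `φ` by Fubini, and finite measures
are determined by their characteristic functions. -/
theorem eq_withDensity_of_charFun_scaleMixture [IsFiniteMeasure κ] (hw : Measurable w)
    (hpos : ∀ᵐ u ∂κ, 0 < w u)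
    (hφ : ∀ s, φ s = ∫ u, Real.exp (-(w u / 2) * s ^ 2) ∂κ) {ρ : Measure ℝ} [IsFiniteMeasure ρ]
    (hρ : ∀ s, charFun ρ s = φ s) :
    ρ = volume.withDensity fun z =>
      ENNReal.ofReal (∫ u, gaussianPDFReal 0 (w u).toNNReal z ∂κ) := by
  have hi := integrable_scaleMixture_density hw hpos
  have : IsFiniteMeasure (volume.withDensity fun z =>
      ENNReal.ofReal (∫ u, gaussianPDFReal 0 (w u).toNNReal z ∂κ)) :=
    isFiniteMeasure_withDensity_ofReal hi.2
  refine Measure.ext_of_charFun (funext fun t => ?_)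
  rw [hρ, charFun_apply_real, hφ, integral_withDensity_eq_integral_toReal_smul₀
    hi.aestronglyMeasurable.aemeasurable.ennreal_ofReal (by simp)]
  simp only [ENNReal.toReal_ofReal (scaleMixture_density_nonneg _), Complex.real_smul,
    ← integral_complex_ofReal, ← integral_mul_const]
  rw [← integral_integral_swap]
  · refine integral_congr_ae (hpos.mono fun u hu => ?_)
    have h := charFun_gaussianReal (μ := 0) (v := (w u).toNNReal) t
    rw [charFun_apply_real, integral_gaussianReal_eq_integral_smul (by simpa using hu)] at h
    simp only [Complex.real_smul] at h
    simp only
    rw [h, Real.coe_toNNReal _ hu.le]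
    push_cast
    ring_nf
  · exact (integrable_prod_gaussianPDFReal hw hpos).ofReal.mul_bdd (c := 1)
      (Measurable.aestronglyMeasurable (by fun_prop))
      (.of_forall fun p => by
        simp only [← Complex.ofReal_mul, Complex.norm_exp_ofReal_mul_I, le_refl])

theorem measureReal_Iic_of_charFun_scaleMixture [IsProbabilityMeasure κ] (hw : Measurable w)
    (hpos : ∀ᵐ u ∂κ, 0 < w u)
    (hint : Integrable (fun u => (Real.sqrt (w u))⁻¹) κ)
    (hφ : ∀ s, φ s = ∫ u, Real.exp (-(w u / 2) * s ^ 2) ∂κ) {ρ : Measure ℝ}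
    [IsProbabilityMeasure ρ] (hρ : ∀ s, charFun ρ s = φ s) (z : ℝ) :
    ρ.real (Set.Iic z) =
      1 / 2 + 1 / Real.pi * ∫ s in Set.Ioi (0 : ℝ), Real.sin (s * z) * φ s / s := by
  have hi := integrable_scaleMixture_density hw hpos
  have hφi := integrable_of_scaleMixture hw hpos hint hφ
  have hd := eq_withDensity_of_charFun_scaleMixture hw hpos hφ hρ
  set f : ℝ → ℝ := fun z => ∫ u, gaussianPDFReal 0 (w u).toNNReal z ∂κ with hf
  have hf0 : ∀ x, 0 ≤ f x := fun x => scaleMixture_density_nonneg x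
  have hreal : ∀ s, MeasurableSet s → ρ.real s = ∫ x in s, f x := by
    intro s hs
    rw [hd, measureReal_def, withDensity_apply _ hs,
      ← ofReal_integral_eq_lintegral_ofReal hi.integrableOn (.of_forall hf0),
      ENNReal.toReal_ofReal (integral_nonneg hf0)]
  -- The density is even with total mass one.
  have hhalf : ∫ x in Set.Iic 0, f x = 1 / 2 := by
    have h1 : ∫ x, f x = 1 := by
      rw [← setIntegral_univ, ← hreal _ .univ, probReal_univ]
    have h2 : ∫ x, f |x| = ∫ x, f x := by
      refine integral_congr_ae (.of_forall fun x => ?_)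
      simp [hf, gaussianPDFReal]
    have h3 := integral_add_compl (measurableSet_Iic (a := (0 : ℝ))) hi
    rw [Set.compl_Iic] at h3
    rw [integral_comp_abs] at h2
    linarith
  have hdiff := intervalIntegral.integral_Iic_sub_Iic (a := 0) (b := z)
    hi.integrableOn hi.integrableOn
  rw [hreal _ measurableSet_Iic]
  suffices h : ∫ x in (0 : ℝ)..z, f x =
      1 / Real.pi * ∫ s in Set.Ioi (0 : ℝ), Real.sin (s * z) * φ s / s by linarith
  -- Inserting the cosine formula and swapping integrals leaves `∫ cos (s x) dx` over `0..z`, which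
  -- is `sin (s z) / s`.
  simp only [hf, ← integral_cos_mul_scaleMixture hw hpos hint hφ]
  rw [intervalIntegral.integral_const_mul, intervalIntegral_integral_swap]
  · congr 1
    refine setIntegral_congr_fun measurableSet_Ioi fun s hs => ?_
    have hs : s ≠ 0 := ne_of_gt hs
    rw [intervalIntegral.integral_mul_const]
    simp only [mul_comm s]
    rw [intervalIntegral.integral_comp_mul_right _ hs]
    simp
    ring
  · have : IsFiniteMeasure (volume.restrict (Set.uIoc 0 z)) := by
      rw [Set.uIoc]
      infer_instance
    have : Integrable (fun p : ℝ × ℝ => (1 : ℝ) * φ p.2)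
        ((volume.restrict (Set.uIoc 0 z)).prod (volume.restrict (Set.Ioi 0))) :=
      Integrable.mul_prod (integrable_const (1 : ℝ)) hφi.integrableOn
    simp only [one_mul] at this
    exact this.bdd_mul (c := 1) (Measurable.aestronglyMeasurable (by fun_prop))
      (.of_forall fun p => Real.abs_cos_le_one _)

end ScaleMixture

/-! ### Square root, blocks and loadings -/

theorem transpose_matSqrt {n : ℕ} (C : Matrix (Fin n) (Fin n) ℝ) : (matSqrt C)ᵀ = matSqrt C := by
  open scoped MatrixOrder in
  have h := (CFC.sqrt_nonneg C).isSelfAdjoint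
  rw [← conjTranspose_eq_transpose_of_trivial]
  exact h

theorem matSqrt_mul_self {n : ℕ} {C : Matrix (Fin n) (Fin n) ℝ} (hC : C.PosSemidef) :
    matSqrt C * matSqrt C = C := by
  open scoped MatrixOrder in
  exact CFC.sqrt_mul_sqrt_self C (Matrix.nonneg_iff_posSemidef.2 hC)

/-- The vector `P_g' C^{1/2} e_j` of loadings of the `j`-th coordinate on the `g`-th block. -/
noncomputable def blockLoading {G : ℕ} (m : Fin G → ℕ)
    (C P : Matrix (Fin (∑ g, m g)) (Fin (∑ g, m g)) ℝ) (j : Fin (∑ g, m g)) (g : Fin G) :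
    Fin (m g) → ℝ :=
  (colBlock m P g)ᵀ *ᵥ (matSqrt C *ᵥ Pi.single j 1)

section

variable {G : ℕ} {m : Fin G → ℕ} {ν : Fin G → ℝ}
  {C P : Matrix (Fin (∑ g, m g)) (Fin (∑ g, m g)) ℝ}

theorem blockLoading_apply (j : Fin (∑ g, m g)) (g : Fin G) (i : Fin (m g)) :
    blockLoading m C P j g i = (matSqrt C * P) j (finSigmaFinEquiv ⟨g, i⟩) := by
  rw [← transpose_matSqrt C]
  simp only [blockLoading, mulVec_single_one]
  simp [mulVec, dotProduct, colBlock, mul_apply, mul_comm]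

theorem stackBlocks_finSigmaFinEquiv (v : ∀ g, Fin (m g) → ℝ) (g : Fin G) (i : Fin (m g)) :
    stackBlocks m v (finSigmaFinEquiv ⟨g, i⟩) = v g i :=
  congrArg (fun p : Σ g, Fin (m g) => v p.1 p.2) (finSigmaFinEquiv.symm_apply_apply ⟨g, i⟩)

theorem mulVec_stackBlocks_apply (j : Fin (∑ g, m g)) (v : ∀ g, Fin (m g) → ℝ) :
    ((matSqrt C * P) *ᵥ stackBlocks m v) j = ∑ g, blockLoading m C P j g ⬝ᵥ v g := by
  simp only [mulVec, dotProduct, blockLoading_apply]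
  rw [← finSigmaFinEquiv.sum_comp, Fintype.sum_sigma]
  simp only [stackBlocks_finSigmaFinEquiv]

/-- If all loadings vanished, row `j` of `C^{1/2} P` would be zero, and so would `C j j`, because `C
= (C^{1/2} P)(P' C^{1/2})`. -/
theorem exists_blockLoading_ne_zero (hC : C.PosSemidef) (hP : Pᵀ * P = 1) {j : Fin (∑ g, m g)}
    (hj : 0 < C j j) : ∃ g, 0 < ∑ i, blockLoading m C P j g i ^ 2 := by
  by_contra! h
  have hz : ∀ k, (matSqrt C * P) j k = 0 := by
    intro k
    obtain ⟨⟨g, i⟩, rfl⟩ := finSigmaFinEquiv.surjective k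
    have h0 := (Finset.sum_eq_zero_iff_of_nonneg fun i _ => sq_nonneg _).1
      (le_antisymm (h g) (Finset.sum_nonneg fun i _ => sq_nonneg _)) i (Finset.mem_univ _)
    rw [← blockLoading_apply]
    exact pow_eq_zero_iff (two_ne_zero) |>.1 h0
  have hCP : C = matSqrt C * P * (Pᵀ * matSqrt C) := by
    rw [Matrix.mul_assoc, ← Matrix.mul_assoc P, mul_eq_one_comm.1 hP, Matrix.one_mul,
      matSqrt_mul_self hC]
  rw [hCP, mul_apply] at hj
  simp [hz] at hj

theorem measurable_mulVec_stackBlocks (A : Matrix (Fin (∑ g, m g)) (Fin (∑ g, m g)) ℝ) :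
    Measurable fun v : (∀ g, Fin (m g) → ℝ) => A *ᵥ stackBlocks m v := by
  refine measurable_pi_lambda _ fun j => ?_
  simp only [mulVec, dotProduct, stackBlocks]
  fun_prop

/-! ### Characteristic function of a coordinate -/

theorem ctMarginalCF_eq (j : Fin (∑ g, m g)) (s : ℝ) :
    ctMarginalCF m ν C P j s =
      ((∏ g, tStdCF (ν g) (s * ‖WithLp.toLp 2 (blockLoading m C P j g)‖) : ℝ) : ℂ) := by
  simp [ctMarginalCF, blockLoading]

theorem tStdCF_mul_norm {k : ℕ} {ν : ℝ} (hν : 2 < ν) (v : Fin k → ℝ) (s : ℝ) :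
    tStdCF ν (s * ‖WithLp.toLp 2 v‖) =
      ∫ u, Real.exp (-(s ^ 2 * ∑ i, v i ^ 2) / (2 * u)) ∂gammaMeasure (ν / 2) ((ν - 2) / 2) := by
  rw [← integral_exp_neg_div_gammaMeasure hν, mul_pow, EuclideanSpace.real_norm_sq_eq]

theorem integral_cexp_dotProduct_tStd {k : ℕ} {ν : ℝ} (hν : 2 < ν) (v : Fin k → ℝ) (s : ℝ) :
    ∫ y, Complex.exp (s * (v ⬝ᵥ y : ℝ) * Complex.I) ∂tStd ν 1 =
      (tStdCF ν (s * ‖WithLp.toLp 2 v‖) : ℂ) := by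
  have h := integral_cexp_tStd_one hν (s • v)
  rw [tStdCF_mul_norm hν]
  simp only [Pi.smul_apply, smul_eq_mul, mul_pow, ← Finset.mul_sum, smul_dotProduct] at h
  rw [← h]
  simp only [Complex.ofReal_mul, mul_comm Complex.I]

theorem charFun_ctStd_apply {Ω : Type*} [MeasurableSpace Ω] {μ : Measure Ω} (hν : ∀ g, 2 < ν g)
    {Z : Ω → Fin (∑ g, m g) → ℝ} (hZ : HasLaw Z (ctStd m ν (matSqrt C * P)) μ)
    (j : Fin (∑ g, m g)) (s : ℝ) :
    charFun (μ.map fun ω => Z ω j) s = ctMarginalCF m ν C P j s := by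
  have hprob := fun g => isProbabilityMeasure_tStd_one (m := m g) (hν g)
  have hcomp : (fun ω => Z ω j) = (fun x => x j) ∘ Z := rfl
  rw [hcomp, ← AEMeasurable.map_map_of_aemeasurable (measurable_pi_apply j).aemeasurable
      hZ.aemeasurable, hZ.map_eq, ctStd,
    Measure.map_map (measurable_pi_apply j) (measurable_mulVec_stackBlocks _), charFun_apply_real,
    integral_map ((measurable_pi_apply j).comp (measurable_mulVec_stackBlocks _)).aemeasurable
      (Measurable.aestronglyMeasurable (by fun_prop))]
  simp only [Function.comp_apply, mulVec_stackBlocks_apply, Complex.ofReal_sum, Finset.mul_sum,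
    Finset.sum_mul, Complex.exp_sum]
  rw [integral_fintype_prod_eq_prod
    (fun g (y : Fin (m g) → ℝ) =>
      Complex.exp (s * (blockLoading m C P j g ⬝ᵥ y : ℝ) * Complex.I))]
  simp only [integral_cexp_dotProduct_tStd (hν _)]
  rfl

theorem isProbabilityMeasure_tStdReal {ν : ℝ} (hν : 2 < ν) :
    IsProbabilityMeasure (tStdReal ν) := by
  have := isProbabilityMeasure_tStd_one (m := 1) hν
  exact Measure.isProbabilityMeasure_map (measurable_pi_apply 0).aemeasurable

theorem charFun_tStdReal {ν : ℝ} (hν : 2 < ν) (s : ℝ) :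
    charFun (tStdReal ν) s = (tStdCF ν s : ℂ) := by
  have h := integral_cexp_tStd_one hν (fun _ : Fin 1 => s)
  simp only [Finset.univ_unique, Finset.sum_singleton, integral_exp_neg_div_gammaMeasure hν] at h
  rw [← h, charFun_apply_real, tStdReal, integral_map (measurable_pi_apply 0).aemeasurable
    (Measurable.aestronglyMeasurable (by fun_prop))]
  simp [dotProduct, mul_comm]

theorem isProbabilityMeasure_of_hasLaw_ctStd {Ω : Type*} [MeasurableSpace Ω] {μ : Measure Ω}
    (hν : ∀ g, 2 < ν g) {A : Matrix (Fin (∑ g, m g)) (Fin (∑ g, m g)) ℝ}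
    {Z : Ω → Fin (∑ g, m g) → ℝ} (hZ : HasLaw Z (ctStd m ν A) μ) : IsProbabilityMeasure μ := by
  have hprob := fun g => isProbabilityMeasure_tStd_one (m := m g) (hν g)
  have : IsProbabilityMeasure (μ.map Z) := by
    rw [hZ.map_eq, ctStd]
    exact Measure.isProbabilityMeasure_map (measurable_mulVec_stackBlocks A).aemeasurable
  exact Measure.isProbabilityMeasure_of_map Z

/-! ### The mixing variance of a coordinate -/

/-- The characteristic function of a marginal is that of a scale mixture of Gaussians, the mixing
variables being independent and gamma distributed. -/
theorem prod_tStdCF_eq_integral (hν : ∀ g, 2 < ν g) (j : Fin (∑ g, m g)) (s : ℝ) :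
    ∏ g, tStdCF (ν g) (s * ‖WithLp.toLp 2 (blockLoading m C P j g)‖) =
      ∫ u : Fin G → ℝ, Real.exp (-((∑ g, (∑ i, blockLoading m C P j g i ^ 2) / u g) / 2) * s ^ 2)
        ∂Measure.pi fun g => gammaMeasure (ν g / 2) ((ν g - 2) / 2) := by
  have hprob := fun g => isProbabilityMeasure_gammaMeasure (a := ν g / 2) (r := (ν g - 2) / 2)
    (by linarith [hν g]) (by linarith [hν g])
  simp only [tStdCF_mul_norm (hν _)]
  rw [← integral_fintype_prod_eq_prod (𝕜 := ℝ)]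
  refine integral_congr_ae (.of_forall fun u => ?_)
  simp only
  rw [← Real.exp_sum, Finset.sum_div, ← Finset.sum_neg_distrib, Finset.sum_mul]
  congr 1
  refine Finset.sum_congr rfl fun g _ => ?_
  rw [mul_comm 2 (u g), ← div_div]
  ring

theorem ae_pos_pi_gammaMeasure (hν : ∀ g, 2 < ν g) :
    ∀ᵐ u ∂Measure.pi fun g => gammaMeasure (ν g / 2) ((ν g - 2) / 2), ∀ g, 0 < u g := by
  have hprob := fun g => isProbabilityMeasure_gammaMeasure (a := ν g / 2) (r := (ν g - 2) / 2)
    (by linarith [hν g]) (by linarith [hν g])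
  exact ae_all_iff.2 fun g => Measure.tendsto_eval_ae_ae.eventually (ae_pos_gammaMeasure _ _)

/-- Keeping only the term `g₀` bounds the integrand by `√(u g₀) / √(q g₀)`. -/
theorem integrable_inv_sqrt_sum_div (hν : ∀ g, 2 < ν g) {q : Fin G → ℝ} (hq : ∀ g, 0 ≤ q g)
    {g₀ : Fin G} (hg₀ : 0 < q g₀) :
    Integrable (fun u : Fin G → ℝ => (Real.sqrt (∑ g, q g / u g))⁻¹)
      (Measure.pi fun g => gammaMeasure (ν g / 2) ((ν g - 2) / 2)) := by
  have hprob := fun g => isProbabilityMeasure_gammaMeasure (a := ν g / 2) (r := (ν g - 2) / 2)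
    (by linarith [hν g]) (by linarith [hν g])
  have h : Integrable (fun u : Fin G → ℝ => Real.sqrt (u g₀))
      (Measure.pi fun g => gammaMeasure (ν g / 2) ((ν g - 2) / 2)) :=
    integrable_comp_eval (μ := fun g => gammaMeasure (ν g / 2) ((ν g - 2) / 2))
      (integrable_sqrt_gammaMeasure (by linarith [hν g₀]) (by linarith [hν g₀]))
  refine (h.const_mul (Real.sqrt (q g₀))⁻¹).mono' (Measurable.aestronglyMeasurable (by fun_prop)) ?_
  filter_upwards [ae_pos_pi_gammaMeasure hν] with u hu
  have hu0 := hu g₀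
  rw [Real.norm_of_nonneg (by positivity), ← Real.sqrt_inv, ← Real.sqrt_inv,
    ← Real.sqrt_mul (by positivity)]
  refine Real.sqrt_le_sqrt ?_
  have hle : q g₀ / u g₀ ≤ ∑ g, q g / u g :=
    Finset.single_le_sum (f := fun g => q g / u g)
      (fun g _ => div_nonneg (hq g) (hu g).le) (Finset.mem_univ g₀)
  calc (∑ g, q g / u g)⁻¹ ≤ (q g₀ / u g₀)⁻¹ := inv_anti₀ (by positivity) hle
    _ = _ := by rw [inv_div, div_eq_inv_mul]

end

/-! ### Real and imaginary parts, and conclusion -/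

theorem cexp_mul_ofReal_re (s z x : ℝ) :
    (Complex.exp (-Complex.I * s * z) * x).re = Real.cos (s * z) * x := by
  rw [Complex.re_mul_ofReal, show -Complex.I * s * z = ((-(s * z) : ℝ) : ℂ) * Complex.I by
    push_cast; ring, Complex.exp_ofReal_mul_I_re, Real.cos_neg]

theorem cexp_mul_ofReal_im (s z x : ℝ) :
    (Complex.exp (-Complex.I * s * z) * x).im = -(Real.sin (s * z) * x) := by
  rw [Complex.im_mul_ofReal, show -Complex.I * s * z = ((-(s * z) : ℝ) : ℂ) * Complex.I by
    push_cast; ring, Complex.exp_ofReal_mul_I_im, Real.sin_neg, neg_mul]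

theorem integrable_cos_mul {φ : ℝ → ℝ} (hφ : Integrable φ) (z : ℝ) :
    Integrable fun s => Real.cos (s * z) * φ s :=
  hφ.bdd_mul (c := 1) (Measurable.aestronglyMeasurable (by fun_prop))
    (.of_forall fun _ => Real.abs_cos_le_one _)

theorem integrable_sin_mul_div {φ : ℝ → ℝ} (hφ : Integrable φ) (z : ℝ) :
    Integrable fun s => Real.sin (s * z) * φ s / s := by
  have h : Integrable fun s => Real.sin (s * z) / s * φ s :=
    -- The bound `|sin (s z)| ≤ |s z|` controls the quotient by `|z|`; at `s = 0` the quotient is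
    -- `0` by convention.
    hφ.bdd_mul (c := |z|) (Measurable.aestronglyMeasurable (by fun_prop)) (.of_forall fun s => by
      rw [Real.norm_eq_abs, abs_div]
      refine div_le_of_le_mul₀ (abs_nonneg _) (abs_nonneg _) ?_
      rw [← abs_mul, mul_comm z]
      exact Real.abs_sin_le_abs)
  exact h.congr (.of_forall fun s => div_mul_eq_mul_div _ _ _)

/-- The law prescribed for `Z` forces `μ` to be a probability measure, so this is not assumed. -/
theorem proposition1 {Ω : Type*} [MeasurableSpace Ω] (μ : Measure Ω)
    {G : ℕ} (m : Fin G → ℕ) (ν : Fin G → ℝ) (hν : ∀ g, 2 < ν g)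
    (C P : Matrix (Fin (∑ g, m g)) (Fin (∑ g, m g)) ℝ)
    (hC : C.PosSemidef) (hCdiag : ∀ j, 0 < C j j) (hP : Pᵀ * P = 1)
    (Z : Ω → Fin (∑ g, m g) → ℝ) (hZ : HasLaw Z (ctStd m ν (matSqrt C * P)) μ) :
    -- `φ_κ^std` is the characteristic function of the univariate standardized `t` distribution
    (∀ κ : ℝ, 2 < κ → IsProbabilityMeasure (tStdReal κ) ∧
      ∀ s : ℝ, charFun (tStdReal κ) s = (tStdCF κ s : ℂ)) ∧
    ∀ j : Fin (∑ g, m g),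
      -- characteristic function of `Z_j`
      (∀ s : ℝ, charFun (μ.map fun ω => Z ω j) s = ctMarginalCF m ν C P j s) ∧
      -- the integrals below converge absolutely
      (∀ z : ℝ, IntegrableOn
        (fun s : ℝ => (Complex.exp (-Complex.I * s * z) * ctMarginalCF m ν C P j s).re)
        (Set.Ioi 0)) ∧
      (∀ z : ℝ, IntegrableOn
        (fun s : ℝ => (Complex.exp (-Complex.I * s * z) * ctMarginalCF m ν C P j s).im / s)
        (Set.Ioi 0)) ∧
      -- density of `Z_j`
      (∀ z : ℝ, 0 ≤ 1 / Real.pi * ∫ s in Set.Ioi (0 : ℝ),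
        (Complex.exp (-Complex.I * s * z) * ctMarginalCF m ν C P j s).re) ∧
      (μ.map fun ω => Z ω j) = volume.withDensity (fun z : ℝ => ENNReal.ofReal
        (1 / Real.pi * ∫ s in Set.Ioi (0 : ℝ),
          (Complex.exp (-Complex.I * s * z) * ctMarginalCF m ν C P j s).re)) ∧
      -- cumulative distribution function of `Z_j`
      (∀ z : ℝ, μ.real {ω | Z ω j ≤ z} = 1 / 2 - 1 / Real.pi * ∫ s in Set.Ioi (0 : ℝ),
        (Complex.exp (-Complex.I * s * z) * ctMarginalCF m ν C P j s).im / s) := by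

  refine ⟨fun κ hκ => ⟨isProbabilityMeasure_tStdReal hκ, charFun_tStdReal hκ⟩, fun j => ?_⟩
  have hμ := isProbabilityMeasure_of_hasLaw_ctStd hν hZ
  have hprob := fun g => isProbabilityMeasure_gammaMeasure (a := ν g / 2) (r := (ν g - 2) / 2)
    (by linarith [hν g]) (by linarith [hν g])
  have hZj : AEMeasurable (fun ω => Z ω j) μ :=
    (measurable_pi_apply j).comp_aemeasurable hZ.aemeasurable
  have hρ : IsProbabilityMeasure (μ.map fun ω => Z ω j) := Measure.isProbabilityMeasure_map hZj
  have hcf := charFun_ctStd_apply hν hZ j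
  obtain ⟨g₀, hg₀⟩ := exists_blockLoading_ne_zero hC hP (hCdiag j)
  have hq : ∀ g, 0 ≤ ∑ i, blockLoading m C P j g i ^ 2 := fun g =>
    Finset.sum_nonneg fun i _ => sq_nonneg _
  have hmeas : Measurable fun u : Fin G → ℝ => ∑ g, (∑ i, blockLoading m C P j g i ^ 2) / u g := by
    fun_prop
  have hpos : ∀ᵐ u ∂Measure.pi fun g => gammaMeasure (ν g / 2) ((ν g - 2) / 2),
      0 < ∑ g, (∑ i, blockLoading m C P j g i ^ 2) / u g := by
    filter_upwards [ae_pos_pi_gammaMeasure hν] with u hu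
    exact Finset.sum_pos' (fun g _ => div_nonneg (hq g) (hu g).le)
      ⟨g₀, Finset.mem_univ _, div_pos hg₀ (hu g₀)⟩
  have hint := integrable_inv_sqrt_sum_div hν hq hg₀
  have hφ := prod_tStdCF_eq_integral (C := C) (P := P) hν j
  have hcf' := fun s => (hcf s).trans (ctMarginalCF_eq j s)
  have hφi := integrable_of_scaleMixture hmeas hpos hint hφ
  have hdens := integral_cos_mul_scaleMixture hmeas hpos hint hφ
  refine ⟨hcf, ?_⟩
  -- The characteristic function is real, so only `cos (s z) φ(s)` and `-sin (s z) φ(s)` remain.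
  simp only [ctMarginalCF_eq, cexp_mul_ofReal_re, cexp_mul_ofReal_im, neg_div]
  refine ⟨fun z => (integrable_cos_mul hφi z).integrableOn,
    fun z => (integrable_sin_mul_div hφi z).neg.integrableOn, fun z => ?_, ?_, fun z => ?_⟩
  · rw [hdens]
    exact scaleMixture_density_nonneg z
  · simp only [hdens]
    exact eq_withDensity_of_charFun_scaleMixture hmeas hpos hφ hcf'
  · have h := measureReal_Iic_of_charFun_scaleMixture hmeas hpos hint hφ hcf' z
    rw [map_measureReal_apply_of_aemeasurable hZj measurableSet_Iic] at h
    rw [integral_neg, mul_neg, sub_neg_eq_add]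
    exact h
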